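/- **Corollary 6.2.** Let $n\ge 3$. Let $DG_n$ be the simplicial complex whose vertices are the $2$-element subsets of $\{1,\dots,n\}$ (the possible edges of a graph on $n$ vertices) and whose simplices are the edge sets of disconnected graphs on the vertex set $\{1,\dots,n\}$. Let $P=\overline{\mathcal F(DG_n)}$ be the proper part of its face poset, that is, the set of nonempty simplices ordered by inclusion, with the action of the symmetric group $\mathcal S_n$ induced by permuting the graph vertices. Regard $P$ as a category with a unique morphism $a\to b$ whenever $a\le b$, and let $P/\mathcal S_n$ be the quotient acyclic category (the colimit of the action): its objects are the $\mathcal S_n$-orbits of elements of $P$; its morphisms are the classes $[x]$ of morphisms $x$ of $P$, where $[x]=[y]$ if and only if there are morphisms $x=z_1,\dots,z_m=y$ of $P$ such that, for each $i<m$, $z_i$ and $z_{i+1}$ can be written as composites of the same number $t_i\ge 1$ of morphisms whose corresponding factors lie in the same $\mathcal S_n$-orbit; and $[b\le c]\circ[a\le b]=[a\le c]$. Then the nerve $\Delta(P/\mathcal S_n)$ is collapsible. Here the nerve of an acyclic category is the trisp ($\Delta$-complex) whose $t$-simplices are the chains $a_0\to a_1\to\dots\to a_t$ of $t$ composable non-identity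 morphisms, with the usual boundary maps, and a trisp is called collapsible if it can be reduced to a single vertex by a finite sequence of elementary collapses, each of which removes a pair of simplices $\sigma,\tau$ with $\sigma=\partial_i\tau$ for exactly one $i$, such that $\tau$ is the only remaining simplex that has $\sigma$ as a proper face. -/

import Mathlib

open CategoryTheory

/-! ### Trisps (triangulated spaces, Δ-complexes) and collapsibility -/

/-- A trisp, given combinatorially: a set of `t`-simplices for every `t`, and boundary maps
`∂ᵢ` (the `i`-th vertex in the order of the simplex is removed) with the usual relations. -/
structure Trisp where
  simplex : ℕ → Type
  face : ∀ {t : ℕ}, Fin (t + 2) → simplex (t + 1) → simplex t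
  face_face : ∀ {t : ℕ} (i j : Fin (t + 2)), i ≤ j → ∀ σ : simplex (t + 2),
    face i (face j.succ σ) = face j (face i.castSucc σ)

namespace Trisp

/-- The set of all simplices of a trisp. -/
def Simplices (T : Trisp) : Type := Σ t : ℕ, T.simplex t

/-- Elementary collapse of a subtrisp `K` (a set of simplices closed under taking boundary
simplices) onto `L`: a pair of simplices `σ = ∂ᵢ τ` of `K` is removed, where `σ` is a boundary
simplex of codimension one of no other simplex of `K` and in no other way, and `τ` is a boundary
simplex of no simplex of `K`. Then `L` is closed under taking boundary simplices, too. -/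
def ElementaryCollapse (T : Trisp) (K L : Set T.Simplices) : Prop :=
  ∃ (t : ℕ) (σ : T.simplex t) (τ : T.simplex (t + 1)) (i : Fin (t + 2)),
    (⟨t, σ⟩ : T.Simplices) ∈ K ∧ (⟨t + 1, τ⟩ : T.Simplices) ∈ K ∧ T.face i τ = σ ∧
    (∀ (ρ : T.simplex (t + 1)) (j : Fin (t + 2)),
      (⟨t + 1, ρ⟩ : T.Simplices) ∈ K → T.face j ρ = σ → ρ = τ ∧ j = i) ∧
    (∀ (ρ : T.simplex (t + 2)) (j : Fin (t + 3)),
      (⟨t + 2, ρ⟩ : T.Simplices) ∈ K → T.face j ρ ≠ τ) ∧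
    L = K \ {(⟨t, σ⟩ : T.Simplices), (⟨t + 1, τ⟩ : T.Simplices)}

/-- A trisp is collapsible if a finite sequence of elementary collapses reduces it to a
single vertex. -/
def Collapsible (T : Trisp) : Prop :=
  ∃ v : T.simplex 0,
    Relation.ReflTransGen T.ElementaryCollapse Set.univ {(⟨0, v⟩ : T.Simplices)}

end Trisp

/-! ### Acyclic categories and their nerves -/

/-- A morphism is an identity morphism. -/
def IsIdentity {C : Type} [SmallCategory C] {a b : C} (f : a ⟶ b) : Prop :=
  ∃ h : a = b, f = eqToHom h

/-- Acyclic categories: only identity morphisms have inverses, and every morphism from an object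
to itself is the identity. -/
class AcyclicCategory (C : Type) [SmallCategory C] : Prop where
  isIdentity_of_isIso : ∀ {a b : C} (f : a ⟶ b), IsIso f → IsIdentity f
  endo_eq_id : ∀ {a : C} (f : a ⟶ a), f = 𝟙 a

/-- A chain `a₀ ⟶ a₁ ⟶ ⋯ ⟶ aₜ` of `t` composable non-identity morphisms. -/
def IsNonIdentityChain {C : Type} [SmallCategory C] {t : ℕ} (F : ComposableArrows C t) : Prop :=
  ∀ i : Fin t, ¬ IsIdentity (F.map (homOfLE (Fin.castSucc_lt_succ (i := i)).le))

theorem AcyclicCategory.isIdentity_left {C : Type} [SmallCategory C] [AcyclicCategory C]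
    {a b c : C} (f : a ⟶ b) (g : b ⟶ c) (h : IsIdentity (f ≫ g)) : IsIdentity f := by
  obtain ⟨rfl, h⟩ := h
  exact AcyclicCategory.isIdentity_of_isIso f
    ⟨g, by simpa using h, AcyclicCategory.endo_eq_id _⟩

theorem IsNonIdentityChain.map_lt {C : Type} [SmallCategory C] [AcyclicCategory C] {t : ℕ}
    {F : ComposableArrows C t} (hF : IsNonIdentityChain F) {i j : Fin (t + 1)} (hij : i < j) :
    ¬ IsIdentity (F.map (homOfLE hij.le)) := by
  intro h
  have hit : (i : ℕ) < t := by have := j.isLt; have : (i : ℕ) < j := hij; omega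
  let k : Fin t := ⟨i, hit⟩
  have h1 : k.castSucc ≤ k.succ := (Fin.castSucc_lt_succ (i := k)).le
  have h2 : k.succ ≤ j := by
    rw [Fin.le_def]; exact hij
  have h3 : F.map (homOfLE hij.le) = F.map (homOfLE h1) ≫ F.map (homOfLE h2) := by
    rw [← F.map_comp]; rfl
  rw [h3] at h
  exact hF k (AcyclicCategory.isIdentity_left _ _ h)

/-- The `i`-th boundary of a chain: the object `aᵢ` is dropped, and the two morphisms at `aᵢ` are
composed (or the single one is dropped if `aᵢ` is the first or the last object). -/
def chainFace {C : Type} [SmallCategory C] {t : ℕ} (i : Fin (t + 2))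
    (F : ComposableArrows C (t + 1)) : ComposableArrows C t :=
  F.whiskerLeft (Fin.strictMono_succAbove i).monotone.functor

theorem IsNonIdentityChain.chainFace {C : Type} [SmallCategory C] [AcyclicCategory C] {t : ℕ}
    (i : Fin (t + 2)) {F : ComposableArrows C (t + 1)} (hF : IsNonIdentityChain F) :
    IsNonIdentityChain (chainFace i F) := fun k =>
  hF.map_lt (Fin.strictMono_succAbove i (Fin.castSucc_lt_succ (i := k)))

/-- The nerve `Δ(C)` of an acyclic category. -/
def acyclicNerve (C : Type) [SmallCategory C] [AcyclicCategory C] : Trisp where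
  simplex t := { F : ComposableArrows C t // IsNonIdentityChain F }
  face i F := ⟨chainFace i F.1, F.2.chainFace i⟩
  face_face {t} i j hij F := by
    apply Subtype.ext
    have key : ∀ k : Fin (t + 1),
        j.succ.succAbove (i.succAbove k) = i.castSucc.succAbove (j.succAbove k) := by
      intro k
      have := congrArg (fun f => f.toOrderHom k) (SimplexCategory.δ_comp_δ (n := t) hij)
      exact this
    refine CategoryTheory.Functor.ext (fun k => congrArg F.1.obj (key k)) (fun k l f => ?_)
    have aux : ∀ {a b a' b' : Fin (t + 3)} (p : a ⟶ b) (q : a' ⟶ b') (ha : a = a') (hb : b = b'),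
        F.1.map p = eqToHom (congrArg F.1.obj ha) ≫ F.1.map q ≫
          eqToHom (congrArg F.1.obj hb.symm) := by
      intro a b a' b' p q ha hb
      subst ha hb
      rw [Subsingleton.elim p q]
      simp
    exact aux _ _ (key k) (key l)

/-! ### The quotient `P/G` of a finite poset by a group action

A poset is regarded as a category with a unique morphism `a ⟶ b` whenever `a ≤ b`. The quotient
is the colimit, in acyclic categories, of the action; it is given here by its explicit
description. -/

namespace PosetQuotient

section

variable (G P : Type) [Group G] [PartialOrder P] [MulAction G P]

/-- The morphisms `a ≤ b` of the poset `P`. -/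
abbrev Mor : Type := { p : P × P // p.1 ≤ p.2 }

variable {P}

/-- `Matched G a b a' b'`: the morphisms `a ≤ b` and `a' ≤ b'` have decompositions of the same
(positive) length, such that corresponding pieces lie in the same `G`-orbit of morphisms. -/
inductive Matched : P → P → P → P → Prop
  | single {a b : P} (g : G) (h : a ≤ b) : Matched a b (g • a) (g • b)
  | append {a b c a' b' c' : P} : Matched a b a' b' → Matched b c b' c' → Matched a c a' c'

variable (P)

/-- Two morphisms of `P` become equal in `P/G` if they are connected by a finite sequence of
morphisms in which consecutive ones have matching decompositions. -/
def morSetoid : Setoid (Mor P) :=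
  Relation.EqvGen.setoid fun x y => Matched G x.1.1 x.1.2 y.1.1 y.1.2

/-- The classes `[x]` of morphisms `x` of `P`. -/
abbrev MorClass : Type := Quotient (morSetoid G P)

variable {P}

/-- The class of the morphism `a ≤ b`. -/
def cls {a b : P} (h : a ≤ b) : MorClass G P := Quotient.mk (morSetoid G P) ⟨(a, b), h⟩

/-- The orbit of an object. -/
def orb (a : P) : MulAction.orbitRel.Quotient G P := Quotient.mk (MulAction.orbitRel G P) a

variable {G}

theorem orb_eq_iff {G P : Type} [Group G] [MulAction G P] {a b : P} :
    orb G a = orb G b ↔ ∃ g : G, g • a = b := by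
  unfold orb
  rw [Quotient.eq, MulAction.orbitRel_apply]
  constructor
  · rintro ⟨g, hg⟩
    exact ⟨g⁻¹, by simp only at hg; rw [← hg, inv_smul_smul]⟩
  · rintro ⟨g, rfl⟩
    exact ⟨g⁻¹, by simp⟩

theorem Matched.left {a b a' b' : P} (h : Matched G a b a' b') : ∃ g : G, g • a = a' := by
  induction h with
  | single g _ => exact ⟨g, rfl⟩
  | append _ _ ih _ => exact ih

theorem Matched.right {a b a' b' : P} (h : Matched G a b a' b') : ∃ g : G, g • b = b' := by
  induction h with
  | single g _ => exact ⟨g, rfl⟩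
  | append _ _ _ ih => exact ih

theorem eqv_left [CovariantClass G P (· • ·) (· ≤ ·)] {x y : Mor P} (h : morSetoid G P x y) :
    ∃ g : G, g • x.1.2 = y.1.2 ∧ ∀ (c : P) (hx : x.1.2 ≤ c) (hy : y.1.2 ≤ g • c),
      cls G (x.2.trans hx) = cls G (y.2.trans hy) := by
  induction h with
  | rel x y h =>
    obtain ⟨g, hg⟩ := h.right
    refine ⟨g, hg, fun c hx hy => Quotient.sound (Relation.EqvGen.rel _ _ ?_)⟩
    refine Matched.append h ?_
    have := Matched.single g hx
    rwa [hg] at this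
  | refl x => exact ⟨1, by simp, fun c hx hy => by simp⟩
  | symm x y _ ih =>
    obtain ⟨g, hg, ih⟩ := ih
    refine ⟨g⁻¹, by rw [← hg, inv_smul_smul], fun c hx hy => ?_⟩
    have := ih (g⁻¹ • c) hy (by simpa using hx)
    rw [this]
    simp
  | trans x y z _ _ ih₁ ih₂ =>
    obtain ⟨g, hg, ih₁⟩ := ih₁
    obtain ⟨k, hk, ih₂⟩ := ih₂
    refine ⟨k * g, by rw [mul_smul, hg, hk], fun c hx hy => ?_⟩
    have h1 : y.1.2 ≤ g • c := by
      rw [← hg]; exact CovariantClass.elim g hx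
    rw [ih₁ c hx h1, ih₂ (g • c) h1 (by rwa [mul_smul] at hy)]
    simp [mul_smul]

theorem eqv_right [CovariantClass G P (· • ·) (· ≤ ·)] {x y : Mor P} (h : morSetoid G P x y) :
    ∃ g : G, g • x.1.1 = y.1.1 ∧ ∀ (c : P) (hx : c ≤ x.1.1) (hy : g • c ≤ y.1.1),
      cls G (hx.trans x.2) = cls G (hy.trans y.2) := by
  induction h with
  | rel x y h =>
    obtain ⟨g, hg⟩ := h.left
    refine ⟨g, hg, fun c hx hy => Quotient.sound (Relation.EqvGen.rel _ _ ?_)⟩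
    refine Matched.append (b := x.1.1) (b' := y.1.1) ?_ h
    have := Matched.single g hx
    rwa [hg] at this
  | refl x => exact ⟨1, by simp, fun c hx hy => by simp⟩
  | symm x y _ ih =>
    obtain ⟨g, hg, ih⟩ := ih
    refine ⟨g⁻¹, by rw [← hg, inv_smul_smul], fun c hx hy => ?_⟩
    have := ih (g⁻¹ • c) hy (by simpa using hx)
    rw [this]
    simp
  | trans x y z _ _ ih₁ ih₂ =>
    obtain ⟨g, hg, ih₁⟩ := ih₁
    obtain ⟨k, hk, ih₂⟩ := ih₂
    refine ⟨k * g, by rw [mul_smul, hg, hk], fun c hx hy => ?_⟩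
    have h1 : g • c ≤ y.1.1 := by
      rw [← hg]; exact CovariantClass.elim g hx
    rw [ih₁ c hx h1, ih₂ (g • c) h1 (by rwa [mul_smul] at hy)]
    simp [mul_smul]

theorem cls_smul [CovariantClass G P (· • ·) (· ≤ ·)] (g : G) {a b : P} (h : a ≤ b)
    (h' : g • a ≤ g • b) : cls G h' = cls G h :=
  (Quotient.sound (Relation.EqvGen.rel (⟨(a, b), h⟩ : Mor P) (⟨(g • a, g • b), h'⟩ : Mor P)
    (Matched.single g h))).symm

/-- Composition of classes is well defined. -/
theorem cls_trans_congr [CovariantClass G P (· • ·) (· ≤ ·)] {a b c a' b' c' : P}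
    (h₁ : a ≤ b) (h₂ : b ≤ c) (h₁' : a' ≤ b') (h₂' : b' ≤ c')
    (e₁ : cls G h₁ = cls G h₁') (e₂ : cls G h₂ = cls G h₂') :
    cls G (h₁.trans h₂) = cls G (h₁'.trans h₂') := by
  obtain ⟨g, hg, H⟩ := eqv_left (Quotient.exact e₁)
  simp only at hg H
  have hgc : b' ≤ g • c := hg ▸ CovariantClass.elim (r := (· ≤ ·)) (μ := (· • ·)) g h₂
  rw [H c h₂ hgc]
  have e₃ : cls G hgc = cls G h₂' := by
    rw [← e₂]
    subst hg
    exact cls_smul g h₂ hgc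
  obtain ⟨k, hk, K⟩ := eqv_right (Quotient.exact e₃)
  simp only at hk K
  have hka : k • a' ≤ b' := by
    have := CovariantClass.elim (r := (· ≤ ·)) (μ := (· • ·)) k h₁'
    simp only at this
    rwa [hk] at this
  rw [K a' h₁' hka]
  refine (Quotient.sound (Relation.EqvGen.rel _ _ ?_)).symm
  have m₁ := Matched.single k h₁'
  rw [hk] at m₁
  have m₂ := Matched.single (1 : G) h₂'
  simp only [one_smul] at m₂
  exact m₁.append m₂

/-- The source of a class of morphisms. -/
def src : MorClass G P → MulAction.orbitRel.Quotient G P :=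
  Quotient.lift (fun x => orb G x.1.1) fun x y h => by
    induction h with
    | rel x y h => exact orb_eq_iff.2 h.left
    | refl x => rfl
    | symm x y _ ih => exact ih.symm
    | trans x y z _ _ ih₁ ih₂ => exact ih₁.trans ih₂

/-- The target of a class of morphisms. -/
def tgt : MorClass G P → MulAction.orbitRel.Quotient G P :=
  Quotient.lift (fun x => orb G x.1.2) fun x y h => by
    induction h with
    | rel x y h => exact orb_eq_iff.2 h.right
    | refl x => rfl
    | symm x y _ ih => exact ih.symm
    | trans x y z _ _ ih₁ ih₂ => exact ih₁.trans ih₂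

theorem src_cls {a b : P} (h : a ≤ b) : src (cls G h) = orb G a := rfl

theorem tgt_cls {a b : P} (h : a ≤ b) : tgt (cls G h) = orb G b := rfl

theorem exists_rep (q : MorClass G P) : ∃ (a b : P) (h : a ≤ b), q = cls G h := by
  induction q using Quotient.inductionOn with
  | h x => exact ⟨x.1.1, x.1.2, x.2, rfl⟩

theorem exists_rep_of_src [CovariantClass G P (· • ·) (· ≤ ·)] (q : MorClass G P) (a : P)
    (hq : src q = orb G a) : ∃ (b : P) (h : a ≤ b), q = cls G h := by
  obtain ⟨a', b, h, rfl⟩ := exists_rep q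
  obtain ⟨g, rfl⟩ := orb_eq_iff.1 hq
  exact ⟨g • b, CovariantClass.elim g h, (cls_smul g h _).symm⟩

theorem exists_comp [CovariantClass G P (· • ·) (· ≤ ·)] (p q : MorClass G P)
    (hpq : tgt p = src q) :
    ∃ r : MorClass G P, ∃ (a b c : P) (h₁ : a ≤ b) (h₂ : b ≤ c),
      p = cls G h₁ ∧ q = cls G h₂ ∧ r = cls G (h₁.trans h₂) := by
  obtain ⟨a, b, h₁, rfl⟩ := exists_rep p
  obtain ⟨c, h₂, rfl⟩ := exists_rep_of_src q b hpq.symm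
  exact ⟨_, a, b, c, h₁, h₂, rfl, rfl, rfl⟩

/-- The composite of two classes of morphisms: `[b ≤ c] ∘ [a ≤ b] = [a ≤ c]`. -/
noncomputable def compCls [CovariantClass G P (· • ·) (· ≤ ·)] (p q : MorClass G P)
    (hpq : tgt p = src q) : MorClass G P := (exists_comp p q hpq).choose

theorem compCls_cls [CovariantClass G P (· • ·) (· ≤ ·)] {a b c : P} (h₁ : a ≤ b) (h₂ : b ≤ c)
    (hpq : tgt (cls G h₁) = src (cls G h₂)) :
    compCls (cls G h₁) (cls G h₂) hpq = cls G (h₁.trans h₂) := by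
  obtain ⟨a', b', c', h₁', h₂', e₁, e₂, e₃⟩ := (exists_comp _ _ hpq).choose_spec
  exact e₃.trans (cls_trans_congr h₁ h₂ h₁' h₂' e₁ e₂).symm

end

/-- The quotient `P/G`; its objects are the `G`-orbits of objects of `P`. -/
def OrbitCat (G P : Type) [Group G] [PartialOrder P] [MulAction G P] : Type :=
  MulAction.orbitRel.Quotient G P

/-- The morphisms of `P/G` are the classes of morphisms of `P`. -/
noncomputable instance (G P : Type) [Group G] [PartialOrder P] [MulAction G P]
    [CovariantClass G P (· • ·) (· ≤ ·)] : SmallCategory (OrbitCat G P) where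
  Hom X Y := { q : MorClass G P // src q = X ∧ tgt q = Y }
  id X := ⟨Quotient.lift (fun a : P => cls G (le_refl a)) (fun a b h => by
      obtain ⟨g, rfl⟩ := orb_eq_iff.1 (Quotient.sound h)
      exact (cls_smul g _ _).symm) X, by
    induction X using Quotient.inductionOn with
    | h a => exact ⟨rfl, rfl⟩⟩
  comp {X Y Z} p q := ⟨compCls p.1 q.1 (p.2.2.trans q.2.1.symm), by
    obtain ⟨p, rfl, rfl⟩ := p
    obtain ⟨q, hq, rfl⟩ := q
    obtain ⟨a, b, h₁, rfl⟩ := exists_rep p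
    obtain ⟨c, h₂, rfl⟩ := exists_rep_of_src q b hq
    simp only [compCls_cls]
    exact ⟨rfl, rfl⟩⟩
  id_comp {X Y} p := by
    obtain ⟨p, rfl, rfl⟩ := p
    obtain ⟨a, b, h₁, rfl⟩ := exists_rep p
    exact Subtype.ext (compCls_cls (le_refl a) h₁ rfl)
  comp_id {X Y} p := by
    obtain ⟨p, rfl, rfl⟩ := p
    obtain ⟨a, b, h₁, rfl⟩ := exists_rep p
    exact Subtype.ext (compCls_cls h₁ (le_refl b) rfl)
  assoc {W X Y Z} p q r := by
    obtain ⟨p, rfl, rfl⟩ := p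
    obtain ⟨q, hq, rfl⟩ := q
    obtain ⟨r, hr, rfl⟩ := r
    obtain ⟨a, b, h₁, rfl⟩ := exists_rep p
    obtain ⟨c, h₂, rfl⟩ := exists_rep_of_src q b hq
    obtain ⟨d, h₃, rfl⟩ := exists_rep_of_src r c hr
    apply Subtype.ext
    simp only [compCls_cls]

theorem le_antisymm_orbit {G P : Type} [Group G] [Finite G] [PartialOrder P] [MulAction G P]
    [CovariantClass G P (· • ·) (· ≤ ·)] {a : P} {g : G} (h : a ≤ g • a) : g • a = a := by
  have key : ∀ m : ℕ, g • a ≤ g ^ (m + 1) • a := by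
    intro m
    induction m with
    | zero => simp
    | succ m ih =>
      refine ih.trans ?_
      have := CovariantClass.elim (r := (· ≤ ·)) (μ := (· • ·)) (g ^ (m + 1)) h
      simpa [pow_succ, mul_smul] using this
  have h1 := key (orderOf g - 1)
  rw [Nat.sub_add_cancel (orderOf_pos g), pow_orderOf_eq_one, one_smul] at h1
  exact le_antisymm h1 h

instance (G P : Type) [Group G] [Finite G] [PartialOrder P] [MulAction G P]
    [CovariantClass G P (· • ·) (· ≤ ·)] : AcyclicCategory (OrbitCat G P) := by
  have endo : ∀ {X : OrbitCat G P} (f : X ⟶ X), f = 𝟙 X := by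
    intro X f
    obtain ⟨q, rfl, h⟩ := f
    obtain ⟨a, b, hab, rfl⟩ := exists_rep q
    obtain ⟨g, rfl⟩ := orb_eq_iff.1 (show orb G a = orb G b from h.symm)
    apply Subtype.ext
    change cls G hab = cls G (le_refl a)
    unfold cls
    congr 1
    exact Subtype.ext (Prod.ext rfl (le_antisymm_orbit hab))
  refine ⟨fun {X Y} f hf => ?_, endo⟩
  have hXY : X = Y := by
    have k := inv f
    obtain ⟨q, rfl, rfl⟩ := f
    obtain ⟨a, b, hab, rfl⟩ := exists_rep q
    obtain ⟨r, hr, hr'⟩ := k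
    obtain ⟨c, hbc, rfl⟩ := exists_rep_of_src r b hr
    obtain ⟨g, rfl⟩ := orb_eq_iff.1 (show orb G a = orb G c from hr'.symm)
    have := le_antisymm_orbit (hab.trans hbc)
    rw [this] at hbc
    exact congrArg (orb G) (le_antisymm hab hbc)
  subst hXY
  exact ⟨rfl, endo f⟩

end PosetQuotient

/-! ### The complex of disconnected graphs -/

/-- Vassiliev's complex `DGₙ` of disconnected graphs: the vertices are the `2`-element subsets of
`{1, …, n}`, i.e. the possible edges of a graph on `n` vertices, and the (nonempty) faces are the
edge sets of disconnected graphs. -/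
def DG (n : ℕ) : PreAbstractSimplicialComplex { e : Sym2 (Fin n) // ¬ e.IsDiag } where
  faces := { E | E.Nonempty ∧
    ¬ (SimpleGraph.fromEdgeSet (Subtype.val '' (E : Set { e : Sym2 (Fin n) // ¬ e.IsDiag })) :
      SimpleGraph (Fin n)).Connected }
  isRelLowerSet_faces := fun _ hE => ⟨hE.1, fun _ hE' hne => ⟨hne, fun hconn => hE.2 <|
    hconn.mono <| SimpleGraph.fromEdgeSet_mono <| Set.image_mono <| Finset.coe_subset.2 hE'⟩⟩

/-- The proper part of the face poset of `DGₙ`: the nonempty faces (nonempty edge sets of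
disconnected graphs), ordered by inclusion. -/
abbrev FDG (n : ℕ) : Type := { E // E ∈ (DG n).faces }

/-- A permutation of the graph vertices acts on the possible edges. -/
instance (n : ℕ) : MulAction (Equiv.Perm (Fin n)) { e : Sym2 (Fin n) // ¬ e.IsDiag } where
  smul g e := ⟨e.1.map g, fun h => e.2 ((Sym2.isDiag_map g.injective).1 h)⟩
  one_smul e := Subtype.ext (congrFun Sym2.map_id e.1)
  mul_smul g h e := Subtype.ext (Sym2.map_map (g := (g : Fin n → Fin n)) (f := h) e.1).symm

theorem edge_smul_val {n : ℕ} (g : Equiv.Perm (Fin n)) (e : { e : Sym2 (Fin n) // ¬ e.IsDiag }) :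
    (g • e).1 = e.1.map g := rfl

open scoped Pointwise in
theorem smul_mem_DG {n : ℕ} (g : Equiv.Perm (Fin n))
    {E : Finset { e : Sym2 (Fin n) // ¬ e.IsDiag }} (hE : E ∈ (DG n).faces) :
    g • E ∈ (DG n).faces := by
  refine ⟨hE.1.smul_finset, fun h => hE.2 ?_⟩
  refine (SimpleGraph.Iso.connected_iff (⟨g, ?_⟩ : SimpleGraph.fromEdgeSet _ ≃g _)).2 h
  intro a b
  simp only [SimpleGraph.fromEdgeSet_adj, ne_eq, EmbeddingLike.apply_eq_iff_eq]
  refine and_congr_left fun _ => ?_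
  constructor
  · rintro ⟨e, he, hab⟩
    rw [Finset.mem_coe, Finset.mem_smul_finset] at he
    obtain ⟨e', he', rfl⟩ := he
    refine ⟨e', he', Sym2.map.injective g.injective ?_⟩
    rw [← edge_smul_val, hab]; rfl
  · rintro ⟨e, he, hab⟩
    refine ⟨g • e, Finset.smul_mem_smul_finset he, ?_⟩
    rw [edge_smul_val, hab]; rfl

open scoped Pointwise in
/-- The induced action of the symmetric group `𝒮ₙ` on the face poset: the permutation `g` takes
the edge set `E` to `{g • e | e ∈ E}`. -/
instance (n : ℕ) : MulAction (Equiv.Perm (Fin n)) (FDG n) where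
  smul g E := ⟨g • E.1, smul_mem_DG g E.2⟩
  one_smul E := Subtype.ext (one_smul _ E.1)
  mul_smul g h E := Subtype.ext (mul_smul g h E.1)

open scoped Pointwise in
instance (n : ℕ) : CovariantClass (Equiv.Perm (Fin n)) (FDG n) (· • ·) (· ≤ ·) where
  elim g _ _ h := Finset.smul_finset_subset_smul_finset (a := g) h

/-! The orbit of the single edges is an initial object of the quotient category, and the nerve of a
finite acyclic category with an initial object is a cone, hence collapsible.

Existence of morphisms: every simplex is nonempty, and all edges lie in one orbit. Uniqueness: for
edges `e`, `f` of a disconnected graph `E`, some permutation exchanges `e` and `f` and therefore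
fixes `{e, f}`. The decompositions `{e} ≤ {e, f} ≤ E` and `{f} ≤ {e, f} ≤ E` then match piece by
piece, so `{e} ≤ E` and `{f} ≤ E` have the same class (`cls_singleton_eq`). This uses matching of
decompositions: no single permutation need carry the pair `({e}, E)` to `({f}, E)`.

Collapsibility: the chains that do not start at the initial object `X` form the base. Each base
chain is paired with the chain obtained by prepending `X`, and the pairs are removed in order of
decreasing dimension until only the vertex `X` is left (`Trisp.collapsible_of_cone`). -/

/-! ### Collapsing a cone to its apex. -/

namespace Trisp

/-- The set of simplices of a trisp consisting of a vertex `v`, a set `A` of simplices, and the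
cones over those elements of `A` that lie in the base `B`. -/
def coneSet (T : Trisp) (v : T.simplex 0) {B : Set T.Simplices}
    (cone : ∀ {t : ℕ} (σ : T.simplex t), (⟨t, σ⟩ : T.Simplices) ∈ B → T.simplex (t + 1))
    (A : Set T.Simplices) : Set T.Simplices :=
  {p | p = ⟨0, v⟩ ∨ p ∈ A ∨ ∃ (t : ℕ) (σ : T.simplex t) (hσ : (⟨t, σ⟩ : T.Simplices) ∈ B),
    (⟨t, σ⟩ : T.Simplices) ∈ A ∧ p = ⟨t + 1, cone σ hσ⟩}

section Cone

variable {T : Trisp} {v : T.simplex 0} {B : Set T.Simplices}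
  {cone : ∀ {t : ℕ} (σ : T.simplex t), (⟨t, σ⟩ : T.Simplices) ∈ B → T.simplex (t + 1)}

theorem mk_eq_mk_iff {t : ℕ} {σ τ : T.simplex t} :
    (⟨t, σ⟩ : T.Simplices) = ⟨t, τ⟩ ↔ σ = τ :=
  ⟨fun h => eq_of_heq (Sigma.mk.inj h).2, fun h => h ▸ rfl⟩

/-- The pair removed is `a` and its cone. Since `a` has maximal dimension, every simplex one
dimension higher is a cone. Such a cone meets `B` only in its zeroth face, so `a` is a face of its
own cone alone. A simplex having the cone over `a` as a face would need a base simplex of dimension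
above that of `a`. -/
theorem elementaryCollapse_coneSet_insert
    (hv : (⟨0, v⟩ : T.Simplices) ∉ B)
    (face_zero : ∀ {t : ℕ} (σ : T.simplex t) (hσ : (⟨t, σ⟩ : T.Simplices) ∈ B),
      T.face 0 (cone σ hσ) = σ)
    (face_succ : ∀ {t : ℕ} (σ : T.simplex t) (hσ : (⟨t, σ⟩ : T.Simplices) ∈ B) (j : Fin (t + 1)),
      (⟨t, T.face j.succ (cone σ hσ)⟩ : T.Simplices) ∉ B)
    (cone_notMem : ∀ {t : ℕ} (σ : T.simplex t) (hσ : (⟨t, σ⟩ : T.Simplices) ∈ B),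
      (⟨t + 1, cone σ hσ⟩ : T.Simplices) ∉ B)
    {A : Set T.Simplices} {a : T.Simplices} (ha : a ∈ B) (hA : A ⊆ B) (haA : a ∉ A)
    (hmax : ∀ x ∈ A, x.1 ≤ a.1) :
    T.ElementaryCollapse (T.coneSet v cone (insert a A)) (T.coneSet v cone A) := by
  obtain ⟨t, σ⟩ := a
  have hmax' : ∀ x ∈ insert (⟨t, σ⟩ : T.Simplices) A, x.1 ≤ t := by
    rintro x (rfl | hx)
    exacts [le_rfl, hmax x hx]
  refine ⟨t, σ, cone σ ha, 0, Or.inr (Or.inl (Set.mem_insert _ _)),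
    Or.inr (Or.inr ⟨t, σ, ha, Set.mem_insert _ _, rfl⟩), face_zero σ ha, ?_, ?_, ?_⟩
  · rintro ρ j (h | h | ⟨s, q, hqB, hq, h⟩) hρ
    · cases h
    · exact absurd (hmax' _ h) (by simp)
    · obtain rfl : t = s := by simpa using congrArg Sigma.fst h
      obtain rfl : ρ = cone q hqB := mk_eq_mk_iff.1 h
      obtain rfl | ⟨j, rfl⟩ := Fin.eq_zero_or_eq_succ j
      · rw [face_zero q hqB] at hρ
        subst hρ
        exact ⟨rfl, rfl⟩
      · exact absurd (hρ ▸ ha) (face_succ q hqB j)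
  · rintro ρ j (h | h | ⟨s, q, hqB, hq, h⟩) -
    · cases h
    · exact absurd (hmax' _ h) (by simp)
    · obtain rfl : t + 1 = s := by simpa using congrArg Sigma.fst h
      exact absurd (hmax' _ hq) (by simp)
  · ext p
    constructor
    · rintro (rfl | hp | ⟨s, q, hqB, hq, rfl⟩)
      · refine ⟨Or.inl rfl, ?_⟩
        rintro (h | h)
        · exact hv (h ▸ ha)
        · cases h
      · refine ⟨Or.inr (Or.inl (Or.inr hp)), ?_⟩
        rintro (rfl | rfl)
        · exact haA hp
        · exact cone_notMem σ ha (hA hp)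
      · refine ⟨Or.inr (Or.inr ⟨s, q, hqB, Or.inr hq, rfl⟩), ?_⟩
        rintro (h | h)
        · exact cone_notMem q hqB (h ▸ ha)
        · obtain rfl : s = t := by simpa using congrArg Sigma.fst h
          -- The zeroth face recovers the base simplex, so coning is injective.
          have h' := congrArg (T.face 0) (mk_eq_mk_iff.1 h)
          rw [face_zero q hqB, face_zero σ ha] at h'
          exact haA (h' ▸ hq)
    · rintro ⟨rfl | (rfl | hp) | ⟨s, q, hqB, h | hq, rfl⟩, hne⟩
      · exact Or.inl rfl
      · exact absurd (Or.inl rfl) hne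
      · exact Or.inr (Or.inl hp)
      · obtain rfl : s = t := by simpa using congrArg Sigma.fst h
        obtain rfl := mk_eq_mk_iff.1 h
        exact absurd (Or.inr rfl) hne
      · exact Or.inr (Or.inr ⟨s, q, hqB, hq, rfl⟩)

/-- A finite trisp which is a cone with apex `v` over the simplices in `B` is collapsible. -/
theorem collapsible_of_cone [Finite T.Simplices]
    (hv : (⟨0, v⟩ : T.Simplices) ∉ B)
    (face_zero : ∀ {t : ℕ} (σ : T.simplex t) (hσ : (⟨t, σ⟩ : T.Simplices) ∈ B),
      T.face 0 (cone σ hσ) = σ)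
    (face_succ : ∀ {t : ℕ} (σ : T.simplex t) (hσ : (⟨t, σ⟩ : T.Simplices) ∈ B) (j : Fin (t + 1)),
      (⟨t, T.face j.succ (cone σ hσ)⟩ : T.Simplices) ∉ B)
    (cone_notMem : ∀ {t : ℕ} (σ : T.simplex t) (hσ : (⟨t, σ⟩ : T.Simplices) ∈ B),
      (⟨t + 1, cone σ hσ⟩ : T.Simplices) ∉ B)
    (hT : ∀ p, p ∈ T.coneSet v cone B) : T.Collapsible := by
  classical
  have key : ∀ A : Finset T.Simplices, (A : Set T.Simplices) ⊆ B →
      Relation.ReflTransGen T.ElementaryCollapse (T.coneSet v cone A) {⟨0, v⟩} := by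
    intro A
    -- Base simplices are inserted in order of increasing dimension, so that the collapses remove
    -- them from the top dimension downwards.
    refine Finset.induction_on_max_value (fun p : T.Simplices => p.1) A ?_ ?_
    · intro _
      have : T.coneSet v cone ((∅ : Finset T.Simplices) : Set T.Simplices) = {⟨0, v⟩} := by
        ext p
        constructor
        · rintro (h | h | ⟨_, _, _, h, _⟩)
          exacts [h, absurd h (Finset.notMem_empty _), absurd h (Finset.notMem_empty _)]
        · exact Or.inl
      rw [this]
    · intro a s has hmax ih hB
      rw [Finset.coe_insert] at hB ⊢
      have hs := (Set.subset_insert _ _).trans hB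
      exact Relation.ReflTransGen.head
        (elementaryCollapse_coneSet_insert hv face_zero face_succ cone_notMem
          (hB (Set.mem_insert _ _)) hs (by simpa using has) (by simpa using hmax)) (ih hs)
  refine ⟨v, ?_⟩
  have := key B.toFinite.toFinset (by simp)
  rwa [Set.Finite.coe_toFinset, Set.eq_univ_of_forall hT] at this

end Cone

end Trisp

/-! ### Nerves of finite acyclic categories. -/

section Nerve

variable {C : Type} [SmallCategory C]

/-- A functor is determined by its effect on arrows, and both arrow categories have finitely many
objects. -/
instance ComposableArrows.finite [Finite C] [∀ X Y : C, Finite (X ⟶ Y)] (t : ℕ) :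
    Finite (ComposableArrows C t) := by
  have : Finite (Arrow C) := by
    rw [Arrow.finite_iff]
    exact ⟨{ fintypeObj := Fintype.ofFinite _, fintypeHom := fun _ _ => Fintype.ofFinite _ }⟩
  have : Finite (Arrow (Fin (t + 1))) := by
    rw [Arrow.finite_iff]
    exact ⟨inferInstance⟩
  refine Finite.of_injective
    (fun (F : ComposableArrows C t) (f : Arrow (Fin (t + 1))) => F.mapArrow.obj f) ?_
  intro F G h
  exact Arrow.functor_ext fun _ _ f => congrFun h (Arrow.mk f)

theorem chainFace_zero {t : ℕ} (F : ComposableArrows C (t + 1)) : chainFace 0 F = F.δ₀ :=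
  congrArg (fun Φ => F.whiskerLeft Φ)
    (CategoryTheory.Functor.ext (fun _ => rfl) (fun _ _ _ => Subsingleton.elim _ _) :
      (Fin.strictMono_succAbove (0 : Fin (t + 2))).monotone.functor = Fin.succFunctor (t + 1))

theorem chainFace_succ_obj_zero {t : ℕ} (j : Fin (t + 1)) (F : ComposableArrows C (t + 1)) :
    (chainFace j.succ F).obj 0 = F.obj 0 := by
  change F.obj (j.succ.succAbove 0) = F.obj 0
  rw [Fin.succAbove_ne_zero_zero (Fin.succ_ne_zero j)]

theorem IsNonIdentityChain.precomp {t : ℕ} {F : ComposableArrows C t} (hF : IsNonIdentityChain F)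
    {X : C} (f : X ⟶ F.left) (hf : ¬ IsIdentity f) : IsNonIdentityChain (F.precomp f) := by
  intro i
  obtain rfl | ⟨j, rfl⟩ := Fin.eq_zero_or_eq_succ i
  · exact hf
  · exact hF j

variable [AcyclicCategory C]

theorem isIdentity_of_eq {a b : C} (f : a ⟶ b) (h : a = b) : IsIdentity f := by
  subst h
  exact ⟨rfl, AcyclicCategory.endo_eq_id f⟩

/-- In an acyclic category, every morphism to an initial object is an identity. -/
theorem isIdentity_of_isInitial {X Y : C} (hX : Limits.IsInitial X) (f : Y ⟶ X) :
    IsIdentity f :=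
  AcyclicCategory.isIdentity_of_isIso f
    ⟨hX.to Y, AcyclicCategory.endo_eq_id _, AcyclicCategory.endo_eq_id _⟩

theorem IsNonIdentityChain.obj_injective {t : ℕ} {F : ComposableArrows C t}
    (hF : IsNonIdentityChain F) : Function.Injective F.obj := by
  intro i j h
  by_contra hne
  rcases lt_or_gt_of_ne hne with hij | hij
  · exact hF.map_lt hij (isIdentity_of_eq _ h)
  · exact hF.map_lt hij (isIdentity_of_eq _ h.symm)

/-- The `t + 1` objects of a chain are distinct, which bounds `t` below the number of objects. -/
instance acyclicNerve.finite_simplices [Finite C] [∀ X Y : C, Finite (X ⟶ Y)] :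
    Finite (acyclicNerve C).Simplices := by
  have hlt : ∀ p : (acyclicNerve C).Simplices, p.1 < Nat.card C := by
    rintro ⟨t, F, hF⟩
    have := Nat.card_le_card_of_injective _ hF.obj_injective
    simpa [Nat.succ_le_iff] using this
  have (t : ℕ) : Finite ((acyclicNerve C).simplex t) :=
    inferInstanceAs (Finite {F : ComposableArrows C t // IsNonIdentityChain F})
  refine Finite.of_injective (β := Σ t : Fin (Nat.card C), (acyclicNerve C).simplex t)
    (fun p => ⟨⟨p.1, hlt p⟩, p.2⟩) ?_
  rintro ⟨t, F⟩ ⟨s, G⟩ h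
  obtain rfl : t = s := by simpa using congrArg (fun x => (x.1 : ℕ)) h
  exact Trisp.mk_eq_mk_iff.2 (by simpa using h)

/-- The nerve of a finite acyclic category with an initial object is collapsible. -/
theorem acyclicNerve_collapsible_of_isInitial [Finite C] [∀ X Y : C, Finite (X ⟶ Y)] {X : C}
    (hX : Limits.IsInitial X) : (acyclicNerve C).Collapsible := by
  -- The base consists of the chains not starting at `X`; the cone prepends the unique morphism from
  -- `X`.
  let B : Set (acyclicNerve C).Simplices := {p | p.2.1.obj 0 ≠ X}
  let cone {t : ℕ} (F : (acyclicNerve C).simplex t)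
      (hF : (⟨t, F⟩ : (acyclicNerve C).Simplices) ∈ B) : (acyclicNerve C).simplex (t + 1) :=
    ⟨F.1.precomp (hX.to _), F.2.precomp _ fun h => hF h.choose.symm⟩
  refine Trisp.collapsible_of_cone (v := ⟨ComposableArrows.mk₀ X, fun i => i.elim0⟩) (B := B)
    (cone := cone) (fun h => h rfl) (fun F hF => Subtype.ext (chainFace_zero _)) ?_
    (fun F hF h => h rfl) ?_
  · exact fun F hF j h => h (chainFace_succ_obj_zero j _)
  · rintro ⟨t, F, hF⟩
    by_cases h0 : F.obj 0 = X
    · cases t with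
      | zero => exact Or.inl (Trisp.mk_eq_mk_iff (T := acyclicNerve C).2 (Subtype.ext (ComposableArrows.ext₀ h0)))
      | succ t =>
        have hδ : IsNonIdentityChain F.δ₀ := fun i => hF i.succ
        have hB : (⟨t, F.δ₀, hδ⟩ : (acyclicNerve C).Simplices) ∈ B := by
          intro h1
          have h1 : F.obj 1 = X := h1
          exact zero_ne_one (hF.obj_injective (h0.trans h1.symm))
        refine Or.inr (Or.inr ⟨t, ⟨F.δ₀, hδ⟩, hB, hB,
          Trisp.mk_eq_mk_iff (T := acyclicNerve C).2 (Subtype.ext ?_)⟩)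
        -- A chain starting at `X` is recovered from its tail, because its first morphism is unique
        -- by initiality.
        refine ComposableArrows.ext_succ h0 rfl ?_
        subst h0
        exact hX.hom_ext _ _
    · exact Or.inr (Or.inl h0)

end Nerve

/-! ### Initial objects of the quotient category. -/

namespace PosetQuotient

instance (G P : Type) [Group G] [PartialOrder P] [MulAction G P] [Finite P] :
    Finite (OrbitCat G P) :=
  inferInstanceAs (Finite (MulAction.orbitRel.Quotient G P))

instance (G P : Type) [Group G] [PartialOrder P] [MulAction G P] [Finite P]
    [CovariantClass G P (· • ·) (· ≤ ·)] (X Y : OrbitCat G P) : Finite (X ⟶ Y) :=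
  inferInstanceAs (Finite {q : MorClass G P // src q = X ∧ tgt q = Y})

/-- The orbit of `a` as an object of `P/G`. -/
def OrbitCat.mk (G : Type) {P : Type} [Group G] [PartialOrder P] [MulAction G P] (a : P) :
    OrbitCat G P :=
  orb G a

/-- The orbit of `a` is an initial object of `P/G` if every element of `P` is above some element
of the orbit of `a`, and if any two morphisms with the same target that start in this orbit
have the same class. -/
noncomputable def isInitialOrb {G P : Type} [Group G] [PartialOrder P] [MulAction G P]
    [CovariantClass G P (· • ·) (· ≤ ·)] (a : P) (ex : ∀ b : P, ∃ g : G, g • a ≤ b)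
    (uniq : ∀ (b : P) (g h : G) (hg : g • a ≤ b) (hh : h • a ≤ b), cls G hg = cls G hh) :
    Limits.IsInitial (OrbitCat.mk G a) := by
  have ex' : ∀ Y : OrbitCat G P, Nonempty (OrbitCat.mk G a ⟶ Y) := by
    intro Y
    induction Y using Quotient.inductionOn with
    | h b =>
      obtain ⟨g, hg⟩ := ex b
      exact ⟨⟨cls G hg, (orb_eq_iff.2 ⟨g, rfl⟩).symm, rfl⟩⟩
  -- Translating a representative by the group makes its target exactly `b`; its source stays in the
  -- orbit of `a`.
  have rep : ∀ (b : P) (f : OrbitCat.mk G a ⟶ OrbitCat.mk G b),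
      ∃ (g : G) (hg : g • a ≤ b), f.1 = cls G hg := by
    rintro b ⟨q, hs, ht⟩
    obtain ⟨c, d, hcd, rfl⟩ := exists_rep q
    obtain ⟨g, hg⟩ := orb_eq_iff.1 (show orb G a = orb G c from hs.symm)
    obtain ⟨k, rfl⟩ := orb_eq_iff.1 (show orb G d = orb G b from ht)
    have hkc : k • c ≤ k • d := CovariantClass.elim k hcd
    refine ⟨k * g, by rwa [mul_smul, hg], ?_⟩
    have e := cls_smul k hcd hkc
    subst hg
    simp only [mul_smul]
    exact e.symm
  refine Limits.IsInitial.ofUniqueHom (fun Y => (ex' Y).some) fun Y m => ?_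
  generalize (ex' Y).some = m'
  induction Y using Quotient.inductionOn with
  | h b =>
    obtain ⟨g, hg, e⟩ := rep b m
    obtain ⟨g', hg', e'⟩ := rep b m'
    exact Subtype.ext (e.trans ((uniq b g g' hg hg').trans e'.symm))

end PosetQuotient

/-! ### Single edges in the complex of disconnected graphs. -/

/-- Any two possible edges are exchanged by some permutation of the graph vertices. -/
theorem exists_perm_swap_edges {n : ℕ} (e f : {e : Sym2 (Fin n) // ¬ e.IsDiag}) :
    ∃ g : Equiv.Perm (Fin n), g • e = f ∧ g • f = e := by
  obtain ⟨e, he⟩ := e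
  obtain ⟨f, hf⟩ := f
  suffices h : ∃ g : Equiv.Perm (Fin n), e.map g = f ∧ f.map g = e by
    obtain ⟨g, h₁, h₂⟩ := h
    exact ⟨g, Subtype.ext h₁, Subtype.ext h₂⟩
  induction e with | _ a b
  induction f with | _ c d
  rw [Sym2.mk_isDiag_iff] at he hf
  simp only [Sym2.map_mk, Sym2.eq_iff]
  -- If the edges share a vertex, the transposition of the other two endpoints exchanges them (it is
  -- the identity when the edges coincide); disjoint edges need two transpositions.
  by_cases hac : a = c
  · exact ⟨Equiv.swap b d, by grind⟩
  by_cases had : a = d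
  · exact ⟨Equiv.swap b c, by grind⟩
  by_cases hbc : b = c
  · exact ⟨Equiv.swap a d, by grind⟩
  by_cases hbd : b = d
  · exact ⟨Equiv.swap a c, by grind⟩
  exact ⟨Equiv.swap a c * Equiv.swap b d, by grind [Equiv.Perm.mul_apply]⟩

/-- A connected graph on `n` vertices has at least `n - 1` edges, and `n - 1 ≥ 2`. -/
theorem singleton_mem_DG {n : ℕ} (hn : 3 ≤ n) (e : {e : Sym2 (Fin n) // ¬ e.IsDiag}) :
    {e} ∈ (DG n).faces := by
  refine ⟨Finset.singleton_nonempty e, fun h => ?_⟩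
  have h₁ := h.card_vert_le_card_edgeSet_add_one
  rw [Nat.card_fin, SimpleGraph.edgeSet_fromEdgeSet, Finset.coe_singleton, Set.image_singleton] at h₁
  have h₂ := Set.ncard_le_ncard (Set.sdiff_subset : {e.1} \ Sym2.diagSet ⊆ {e.1})
  rw [Set.ncard_singleton, ← Nat.card_coe_set_eq] at h₂
  omega

open PosetQuotient Pointwise in
/-- Two single edges of a disconnected graph define the same morphism of the quotient. -/
theorem cls_singleton_eq {n : ℕ} {e f : {e : Sym2 (Fin n) // ¬ e.IsDiag}} {a b E : FDG n}
    (ha : a.1 = {e}) (hb : b.1 = {f}) (haE : a ≤ E) (hbE : b ≤ E) :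
    cls (Equiv.Perm (Fin n)) haE = cls (Equiv.Perm (Fin n)) hbE := by
  classical
  obtain ⟨g, h₁, h₂⟩ := exists_perm_swap_edges e f
  have haE' : a.1 ⊆ E.1 := haE
  have hbE' : b.1 ⊆ E.1 := hbE
  -- The intermediate object `{e, f}` is a face because it lies inside `E`.
  let m : FDG n := ⟨{e, f}, (DG n).isRelLowerSet_faces E.2 |>.2
    (show ({e, f} : Finset _) ⊆ E.1 by rw [ha] at haE'; rw [hb] at hbE'; grind) (by simp)⟩
  have ham : a ≤ m := show a.1 ⊆ {e, f} by rw [ha]; simp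
  have hmE : m ≤ E := show ({e, f} : Finset _) ⊆ E.1 by
    rw [ha] at haE'; rw [hb] at hbE'; grind
  have hga : g • a = b := Subtype.ext (show g • a.1 = b.1 by simp [ha, hb, h₁])
  have hgm : g • m = m := Subtype.ext (show g • ({e, f} : Finset _) = {e, f} by
    simp [Finset.smul_finset_insert, h₁, h₂, Finset.pair_comm])
  refine Quotient.sound (Relation.EqvGen.rel _ _ ?_)
  -- The first pieces are matched by `g`, the common second piece by the identity; they fit together
  -- because `g` fixes `m`.
  have k₁ := Matched.single g ham
  have k₂ := Matched.single (1 : Equiv.Perm (Fin n)) hmE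
  rw [hga, hgm] at k₁
  rw [one_smul, one_smul] at k₂
  exact k₁.append k₂

open Pointwise in
theorem smul_val_of_eq_singleton {n : ℕ} (g : Equiv.Perm (Fin n)) {a : FDG n}
    {e : {e : Sym2 (Fin n) // ¬ e.IsDiag}} (ha : a.1 = {e}) : (g • a).1 = {g • e} :=
  (congrArg (fun E => g • E) ha).trans (Finset.smul_finset_singleton e)

theorem corollary6p2 (n : ℕ) (hn : 3 ≤ n) :
    (acyclicNerve (PosetQuotient.OrbitCat (Equiv.Perm (Fin n)) (FDG n))).Collapsible := by
  have h01 : ¬ (s(⟨0, by omega⟩, ⟨1, by omega⟩) : Sym2 (Fin n)).IsDiag := by simp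
  let e₀ : {e : Sym2 (Fin n) // ¬ e.IsDiag} := ⟨_, h01⟩
  let a : FDG n := ⟨{e₀}, singleton_mem_DG hn e₀⟩
  have smul_a (g : Equiv.Perm (Fin n)) : (g • a).1 = {g • e₀} :=
    smul_val_of_eq_singleton g rfl
  refine acyclicNerve_collapsible_of_isInitial (PosetQuotient.isInitialOrb a ?_ ?_)
  · intro E
    obtain ⟨e, he⟩ := E.2.1
    obtain ⟨g, hg, -⟩ := exists_perm_swap_edges e₀ e
    refine ⟨g, ?_⟩
    change (g • a).1 ⊆ E.1
    rw [smul_a, hg]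
    simpa using he
  · exact fun E g h hg hh => cls_singleton_eq (smul_a g) (smul_a h) hg hh
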